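/- For integers $\ell,n\ge 1$ let $g_\ell(n)$ denote the number of subgroups of $\mathbb{Z}^\ell$ of index $n$. For a function $g:\mathbb{N}\to\mathbb{N}$ define polynomials by $P_0^g(x)=1$ and $$P_n^g(x)=\frac{x}{n}\sum_{k=1}^{n} g(k)\,P_{n-k}^g(x)\qquad(n\ge 1),$$ and put $$\Delta_n^g(x)=\bigl(P_n^g(x)\bigr)^{n+1}-\bigl(P_{n+1}^g(x)\bigr)^{n}.$$ Let $8\le n\le 25$. Then $\Delta_n^{g_3}(x)>0$ and $\Delta_n^{g_4}(x)>0$ for all real $x\ge 1$. -/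

import Mathlib

/-- The number of subgroups of index `n` in the free abelian group `ℤ^l`
(meant for `n ≥ 1`; the value at `n = 0` is never used below). -/
noncomputable def subgroupCount (l n : ℕ) : ℕ :=
  Nat.card {H : AddSubgroup (Fin l → ℤ) // H.index = n}

/-- The polynomials `P_n^g(x)`: `P_0^g(x) = 1` and, for `n ≥ 1`,
`P_n^g(x) = (x / n) * ∑_{k=1}^n g(k) P_{n-k}^g(x)`.
In the successor case the sum is indexed by `i = k - 1`. -/
noncomputable def dArcaisPoly (g : ℕ → ℕ) : ℕ → Polynomial ℝ
  | 0 => 1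
  | n + 1 => Polynomial.C (1 / ((n : ℝ) + 1)) * Polynomial.X *
      ∑ i : Fin (n + 1), Polynomial.C (g (i.val + 1) : ℝ) * dArcaisPoly g (n - i.val)

/-- `Δ_n^g = (P_n^g)^(n+1) - (P_{n+1}^g)^n`. -/
noncomputable def deltaPoly (g : ℕ → ℕ) (n : ℕ) : Polynomial ℝ :=
  dArcaisPoly g n ^ (n + 1) - dArcaisPoly g (n + 1) ^ n

/-! Since `g ≥ 0`, each `P_n` is nonnegative and increasing on `x ≥ 0`. So `P_{n+1}(c')^n <
P_n(c)^(n+1)` at two grid points `c ≤ c'` gives `Δ_n > 0` on all of `[c, c']`, and finitely many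
such comparisons cover a bounded interval starting at `1`.

For the tail `x ≥ c`, the bounds `x^n ≤ n! P_n(x)` and `P_{n+1}(x) ≤ (x/c)^(n+1) P_{n+1}(c)` make
both powers scale like `x^(n(n+1))`, so one comparison at `c` suffices. It can succeed for large `c`
because `n! < (n+1)^n`, the inequality between leading coefficients.

At rational points everything becomes integer arithmetic after scaling by `k! q^k`. The values of
`g` come from `g_{l+1}(n) = ∑_{m ∣ n} m g_l(m)`, proved by splitting subgroups of `ℤ × A`. -/

/-- `n (n-1) ⋯ (n-i+1) q^i`-weighted convolution of two lists, evaluated by Horner's scheme. -/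
def hornerSum (q : ℕ) : List ℕ → List ℕ → ℕ → ℕ
  | a :: as, b :: bs, m => a * b + m * q * hornerSum q as bs (m - 1)
  | _, _, _ => 0

/-- The list of the integers `k! q^k P_k(p/q)` for `k = n, n-1, …, 0`. -/
def scaledValues (gs : List ℕ) (q p : ℕ) : ℕ → List ℕ
  | 0 => [1]
  | n + 1 => (fun L => p * hornerSum q gs L n :: L) (scaledValues gs q p n)

/-- The powers `p^n, …, p, 1`. -/
def powerValues (p : ℕ) : ℕ → List ℕ
  | 0 => [1]
  | n + 1 => p ^ (n + 1) :: powerValues p n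

/-- Comparison of two lists of scaled values at the degrees `8, …, n`. -/
def compareValues : ℕ → List ℕ → List ℕ → Bool
  | n, b :: bs, d :: ds =>
      n.ble 7 || ((n.factorial * d ^ n).blt (b ^ (n + 1) * (n + 1) ^ n) &&
        compareValues (n - 1) bs ds)
  | _, _, _ => false

/-- Comparison along the grid given by `k` steps `p ↦ p + p² / (30 p + 12000)`, starting at `p`. -/
def gridCheck (gs : List ℕ) (q : ℕ) : ℕ → ℕ → List ℕ → Bool
  | 0, p, L => compareValues 25 (powerValues p 25) L
  | k + 1, p, L =>
      (fun p' => (fun L' => compareValues 25 L.tail L' && gridCheck gs q k p' L')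
        (scaledValues gs q p' 26)) (p + p * p / (30 * p + 12000))

/-! ### Monotonicity and growth of `P_n`, and soundness of the integer test -/

section DArcais

variable (g : ℕ → ℕ)

theorem eval_dArcaisPoly_succ (n : ℕ) (x : ℝ) :
    (dArcaisPoly g (n + 1)).eval x = x / ((n : ℝ) + 1) *
      ∑ i ∈ Finset.range (n + 1), (g (i + 1) : ℝ) * (dArcaisPoly g (n - i)).eval x := by
  rw [dArcaisPoly, Finset.sum_range]
  simp only [Polynomial.eval_mul, Polynomial.eval_C, Polynomial.eval_X, Polynomial.eval_finsetSum]
  ring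

theorem eval_dArcaisPoly_zero (x : ℝ) : (dArcaisPoly g 0).eval x = 1 := by
  simp [dArcaisPoly]

theorem eval_dArcaisPoly_nonneg {x : ℝ} (hx : 0 ≤ x) (n : ℕ) :
    0 ≤ (dArcaisPoly g n).eval x := by
  induction n using Nat.strong_induction_on with
  | _ n ih =>
    rcases n with _ | n
    · simp [eval_dArcaisPoly_zero]
    · rw [eval_dArcaisPoly_succ]
      exact mul_nonneg (by positivity) (Finset.sum_nonneg fun i _ =>
        mul_nonneg (by positivity) (ih _ (by omega)))

theorem eval_dArcaisPoly_mono {x y : ℝ} (hx : 0 ≤ x) (hxy : x ≤ y) (n : ℕ) :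
    (dArcaisPoly g n).eval x ≤ (dArcaisPoly g n).eval y := by
  induction n using Nat.strong_induction_on with
  | _ n ih =>
    rcases n with _ | n
    · simp [eval_dArcaisPoly_zero]
    · rw [eval_dArcaisPoly_succ, eval_dArcaisPoly_succ]
      have hy : 0 ≤ y := hx.trans hxy
      refine mul_le_mul (by gcongr) (Finset.sum_le_sum fun i _ => ?_)
        (Finset.sum_nonneg fun i _ => mul_nonneg (by positivity)
          (eval_dArcaisPoly_nonneg g hx _)) (by positivity)
      exact mul_le_mul_of_nonneg_left (ih _ (by omega)) (by positivity)

/-- `P_n(x) / x^n` is decreasing on the positive half-line. -/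
theorem pow_mul_eval_dArcaisPoly_le {c x : ℝ} (hc : 0 ≤ c) (hcx : c ≤ x) (n : ℕ) :
    c ^ n * (dArcaisPoly g n).eval x ≤ x ^ n * (dArcaisPoly g n).eval c := by
  induction n using Nat.strong_induction_on with
  | _ n ih =>
    rcases n with _ | n
    · simp [eval_dArcaisPoly_zero]
    · have hx : 0 ≤ x := hc.trans hcx
      have key : c ^ n * ∑ i ∈ Finset.range (n + 1),
            (g (i + 1) : ℝ) * (dArcaisPoly g (n - i)).eval x ≤
          x ^ n * ∑ i ∈ Finset.range (n + 1),
            (g (i + 1) : ℝ) * (dArcaisPoly g (n - i)).eval c := by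
        rw [Finset.mul_sum, Finset.mul_sum]
        refine Finset.sum_le_sum fun i hi => ?_
        have hin : i ≤ n := Nat.lt_succ_iff.mp (Finset.mem_range.mp hi)
        have h1 := ih (n - i) (by omega)
        have h2 := eval_dArcaisPoly_nonneg g hc (n - i)
        -- Induction handles degree `n - i`; the spare factor is bounded by `c ^ i ≤ x ^ i`.
        have h3 : c ^ n = c ^ i * c ^ (n - i) := by rw [← pow_add]; congr 1; omega
        have h4 : x ^ n = x ^ i * x ^ (n - i) := by rw [← pow_add]; congr 1; omega
        calc c ^ n * ((g (i + 1) : ℝ) * (dArcaisPoly g (n - i)).eval x)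
            = g (i + 1) * (c ^ i * (c ^ (n - i) * (dArcaisPoly g (n - i)).eval x)) := by
              rw [h3]; ring
          _ ≤ g (i + 1) * (x ^ i * (x ^ (n - i) * (dArcaisPoly g (n - i)).eval c)) := by
              have h5 := eval_dArcaisPoly_nonneg g hx (n - i)
              gcongr
          _ = x ^ n * ((g (i + 1) : ℝ) * (dArcaisPoly g (n - i)).eval c) := by
              rw [h4]; ring
      rw [eval_dArcaisPoly_succ, eval_dArcaisPoly_succ]
      have h5 : 0 ≤ c * x / ((n : ℝ) + 1) := by positivity
      have := mul_le_mul_of_nonneg_left key h5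
      calc _ = c * x / ((n : ℝ) + 1) * (c ^ n * ∑ i ∈ Finset.range (n + 1),
            (g (i + 1) : ℝ) * (dArcaisPoly g (n - i)).eval x) := by ring
        _ ≤ _ := this
        _ = _ := by ring

/-- Only the `k = 1` term of the recursion is kept, with `g 1 ≥ 1`. -/
theorem pow_le_factorial_mul_eval_dArcaisPoly (hg : 1 ≤ g 1) {x : ℝ} (hx : 0 ≤ x) (n : ℕ) :
    x ^ n ≤ n.factorial * (dArcaisPoly g n).eval x := by
  induction n with
  | zero => simp [eval_dArcaisPoly_zero]
  | succ n ih =>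
    have h0 : (dArcaisPoly g n).eval x ≤ ∑ i ∈ Finset.range (n + 1),
        (g (i + 1) : ℝ) * (dArcaisPoly g (n - i)).eval x := by
      rw [Finset.sum_range_succ']
      have h1 : (1 : ℝ) ≤ g (0 + 1) := by exact_mod_cast hg
      have h2 := eval_dArcaisPoly_nonneg g hx n
      have h3 : 0 ≤ ∑ i ∈ Finset.range n,
          (g (i + 1 + 1) : ℝ) * (dArcaisPoly g (n - (i + 1))).eval x :=
        Finset.sum_nonneg fun i _ => mul_nonneg (by positivity) (eval_dArcaisPoly_nonneg g hx _)
      have h4 := mul_le_mul_of_nonneg_right h1 h2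
      simp only [Nat.sub_zero]
      linarith
    rw [eval_dArcaisPoly_succ, Nat.factorial_succ]
    push_cast
    calc x ^ (n + 1) = x * x ^ n := by ring
      _ ≤ x * (n.factorial * (dArcaisPoly g n).eval x) := by gcongr
      _ ≤ x * (n.factorial * ∑ i ∈ Finset.range (n + 1),
        (g (i + 1) : ℝ) * (dArcaisPoly g (n - i)).eval x) := by gcongr
      _ = _ := by field_simp

/-- `v` is the list of the numbers `k! q^k P_k(x)` for `k = n, …, 0`. -/
def IsScaledList (q : ℕ) (x : ℝ) : ℕ → List ℕ → Prop
  | 0, v => v = [1]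
  | n + 1, v => ∃ b w, v = b :: w ∧
      (b : ℝ) = (n + 1).factorial * (q : ℝ) ^ (n + 1) * (dArcaisPoly g (n + 1)).eval x ∧
      IsScaledList q x n w

variable {g}

/-- Passing from `(n-i)! q^(n-i)` to the common scale `n! q^n` costs exactly the Horner weight `n ⋯
(n-i+1) q^i`. -/
theorem IsScaledList.hornerSum_eq {q : ℕ} {x : ℝ} {n : ℕ} {v : List ℕ}
    (h : IsScaledList g q x n v) (as : List ℕ) (has : n + 1 ≤ as.length) :
    (hornerSum q as v n : ℝ) = n.factorial * (q : ℝ) ^ n *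
      ∑ i ∈ Finset.range (n + 1), (as.getD i 0 : ℝ) * (dArcaisPoly g (n - i)).eval x := by
  induction n generalizing v as with
  | zero =>
    obtain rfl : v = [1] := h
    rcases as with _ | ⟨a, as⟩
    · simp at has
    · simp [hornerSum, eval_dArcaisPoly_zero]
  | succ n ih =>
    obtain ⟨b, w, rfl, hb, hw⟩ := h
    rcases as with _ | ⟨a, as⟩
    · simp at has
    · rw [hornerSum, Finset.sum_range_succ', Nat.add_sub_cancel]
      push_cast
      rw [ih hw as (by simpa using has), hb, Nat.factorial_succ]
      simp only [List.getD_cons_succ, List.getD_cons_zero]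
      push_cast
      ring

theorem isScaledList_scaledValues {gs : List ℕ} {q p n : ℕ} (hq : 0 < q) (hn : n ≤ gs.length)
    (hgs : ∀ i < gs.length, gs.getD i 0 = g (i + 1)) :
    IsScaledList g q ((p : ℝ) / q) n (scaledValues gs q p n) := by
  induction n with
  | zero => rfl
  | succ n ih =>
    have ih := ih (by omega)
    refine ⟨_, _, rfl, ?_, ih⟩
    have hq' : (q : ℝ) ≠ 0 := by positivity
    push_cast
    rw [ih.hornerSum_eq gs hn, eval_dArcaisPoly_succ, Nat.factorial_succ]
    have : ∀ i ∈ Finset.range (n + 1), (gs.getD i 0 : ℝ) * (dArcaisPoly g (n - i)).eval ((p : ℝ) / q)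
        = (g (i + 1) : ℝ) * (dArcaisPoly g (n - i)).eval ((p : ℝ) / q) := fun i hi => by
      rw [hgs i ((Finset.mem_range.mp hi).trans_le hn)]
    rw [Finset.sum_congr rfl this]
    push_cast
    field_simp
    ring

theorem IsScaledList.tail {q : ℕ} {x : ℝ} {n : ℕ} {v : List ℕ}
    (h : IsScaledList g q x (n + 1) v) : IsScaledList g q x n v.tail := by
  obtain ⟨b, w, rfl, -, hw⟩ := h
  exact hw

/-- The second list starts one degree higher, so its heads pair `P_m(x)` with `P_{m+1}(y)`. -/
theorem compareValues_sound {q : ℕ} {x y : ℝ} {n : ℕ} {u v : List ℕ} (hq : 0 < q)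
    (hu : IsScaledList g q x n u) (hv : IsScaledList g q y (n + 1) v)
    (h : compareValues n u v = true) (m : ℕ) (hm : 8 ≤ m) (hmn : m ≤ n) :
    (dArcaisPoly g (m + 1)).eval y ^ m < (dArcaisPoly g m).eval x ^ (m + 1) := by
  induction n generalizing u v with
  | zero => omega
  | succ n ih =>
    obtain ⟨b, w, rfl, hb, hw⟩ := hu
    obtain ⟨d, z, rfl, hd, hz⟩ := hv
    simp only [compareValues, Bool.or_eq_true, Bool.and_eq_true, Nat.ble_eq, Nat.blt_eq,
      Nat.add_sub_cancel] at h
    -- The stopping guard is false here, since `8 ≤ m ≤ n + 1`.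
    obtain ⟨h1, h2⟩ := h.resolve_left (by omega)
    rcases hmn.lt_or_eq with hlt | rfl
    · exact ih hw hz h2 (by omega)
    · have h3 : ((n + 1).factorial : ℝ) * (d : ℝ) ^ (n + 1) <
          (b : ℝ) ^ (n + 1 + 1) * ((n : ℝ) + 1 + 1) ^ (n + 1) := by exact_mod_cast h1
      rw [hb, hd, Nat.factorial_succ (n + 1)] at h3
      push_cast at h3
      -- The common factor of both sides of the integer comparison.
      have hK : (0 : ℝ) < ((n + 1).factorial : ℝ) ^ (n + 2) *
          (q : ℝ) ^ ((n + 1) * (n + 2)) * ((n : ℝ) + 1 + 1) ^ (n + 1) := by positivity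
      refine lt_of_mul_lt_mul_left ?_ hK.le
      refine lt_of_eq_of_lt ?_ (lt_of_lt_of_eq h3 ?_)
      · simp only [mul_pow, ← pow_mul]; ring
      · simp only [mul_pow, ← pow_mul]; ring

/-- The tail: `p ^ m` replaces `m! q^m P_m(p/q)` by its lower bound, and the powers of `x` cancel.
-/
theorem compareValues_powerValues_sound {q p : ℕ} {x : ℝ} {n : ℕ} {v : List ℕ}
    (hg : 1 ≤ g 1) (hq : 0 < q) (hp : 0 < p) (hx : (p : ℝ) / q ≤ x)
    (hv : IsScaledList g q ((p : ℝ) / q) (n + 1) v)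
    (h : compareValues n (powerValues p n) v = true) (m : ℕ) (hm : 8 ≤ m) (hmn : m ≤ n) :
    (dArcaisPoly g (m + 1)).eval x ^ m < (dArcaisPoly g m).eval x ^ (m + 1) := by
  induction n generalizing v with
  | zero => omega
  | succ n ih =>
    obtain ⟨d, z, rfl, hd, hz⟩ := hv
    simp only [compareValues, powerValues, Bool.or_eq_true, Bool.and_eq_true, Nat.ble_eq,
      Nat.blt_eq, Nat.add_sub_cancel] at h
    obtain ⟨h1, h2⟩ := h.resolve_left (by omega)
    rcases hmn.lt_or_eq with hlt | rfl
    · exact ih hz h2 (by omega)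
    · have hq' : (0 : ℝ) < q := by exact_mod_cast hq
      have hp' : (0 : ℝ) < p := by exact_mod_cast hp
      have hc : (0 : ℝ) < (p : ℝ) / q := by positivity
      have hx0 : 0 < x := hc.trans_le hx
      have h3 : ((n + 1).factorial : ℝ) * (d : ℝ) ^ (n + 1) <
          ((p : ℝ) ^ (n + 1)) ^ (n + 1 + 1) * ((n : ℝ) + 1 + 1) ^ (n + 1) := by exact_mod_cast h1
      have hlow := pow_le_factorial_mul_eval_dArcaisPoly g hg hx0.le (n + 1)
      have hup := pow_mul_eval_dArcaisPoly_le g hc.le hx (n + 1 + 1)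
      have hF : ((n + 1 + 1).factorial : ℝ) = ((n : ℝ) + 1 + 1) * (n + 1).factorial := by
        rw [Nat.factorial_succ (n + 1)]; push_cast; ring
      have hup' : (p : ℝ) ^ (n + 2) * ((n : ℝ) + 1 + 1) * (n + 1).factorial *
          (dArcaisPoly g (n + 1 + 1)).eval x ≤ x ^ (n + 2) * d := by
        rw [hd, hF]
        rw [div_pow, div_mul_eq_mul_div, div_le_iff₀ (by positivity)] at hup
        have := mul_le_mul_of_nonneg_left hup
          (by positivity : (0 : ℝ) ≤ ((n : ℝ) + 1 + 1) * (n + 1).factorial)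
        calc _ = ((n : ℝ) + 1 + 1) * (n + 1).factorial *
              ((p : ℝ) ^ (n + 1 + 1) * (dArcaisPoly g (n + 1 + 1)).eval x) := by ring
          _ ≤ _ := this
          _ = _ := by ring
      have hnn := eval_dArcaisPoly_nonneg g hx0.le (n + 1 + 1)
      have hup2 := pow_le_pow_left₀ (by positivity) hup' (n + 1)
      have hlow2 := pow_le_pow_left₀ (by positivity) hlow (n + 1 + 1)
      have hK : (0 : ℝ) < ((p : ℝ) ^ (n + 1)) ^ (n + 1 + 1) * ((n : ℝ) + 1 + 1) ^ (n + 1) *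
        (n + 1).factorial ^ (n + 2) := by positivity
      refine lt_of_mul_lt_mul_left ?_ hK.le
      have hX : (0 : ℝ) < (x ^ (n + 2)) ^ (n + 1) := by positivity
      have hM : (0 : ℝ) < ((p : ℝ) ^ (n + 1)) ^ (n + 1 + 1) * ((n : ℝ) + 1 + 1) ^ (n + 1) := by
        positivity
      calc _ = ((n + 1).factorial : ℝ) * ((p : ℝ) ^ (n + 2) * ((n : ℝ) + 1 + 1) *
              (n + 1).factorial * (dArcaisPoly g (n + 1 + 1)).eval x) ^ (n + 1) := by
            simp only [mul_pow, ← pow_mul]; ring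
        _ ≤ ((n + 1).factorial : ℝ) * (x ^ (n + 2) * d) ^ (n + 1) := by gcongr
        _ = (((n + 1).factorial : ℝ) * (d : ℝ) ^ (n + 1)) * (x ^ (n + 2)) ^ (n + 1) := by
            rw [mul_pow]; ring
        _ < (((p : ℝ) ^ (n + 1)) ^ (n + 1 + 1) * ((n : ℝ) + 1 + 1) ^ (n + 1)) *
            (x ^ (n + 2)) ^ (n + 1) := mul_lt_mul_of_pos_right h3 hX
        _ = (((p : ℝ) ^ (n + 1)) ^ (n + 1 + 1) * ((n : ℝ) + 1 + 1) ^ (n + 1)) *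
            (x ^ (n + 1)) ^ (n + 1 + 1) := by rw [← pow_mul x, ← pow_mul x, mul_comm (n + 2)]
        _ ≤ (((p : ℝ) ^ (n + 1)) ^ (n + 1 + 1) * ((n : ℝ) + 1 + 1) ^ (n + 1)) *
            ((n + 1).factorial * (dArcaisPoly g (n + 1)).eval x) ^ (n + 1 + 1) := by gcongr
        _ = _ := by simp only [mul_pow]; ring

theorem gridCheck_sound {gs : List ℕ} {q : ℕ} (hq : 0 < q) (hlen : gs.length = 26)
    (hgs : ∀ i < gs.length, gs.getD i 0 = g (i + 1)) (hg : 1 ≤ g 1) {k p : ℕ} (hp : 0 < p)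
    (h : gridCheck gs q k p (scaledValues gs q p 26) = true) {x : ℝ} (hx : (p : ℝ) / q ≤ x)
    {n : ℕ} (hn : 8 ≤ n) (hn' : n ≤ 25) : 0 < (deltaPoly g n).eval x := by
  have hlist : ∀ p : ℕ, IsScaledList g q ((p : ℝ) / q) 26 (scaledValues gs q p 26) := fun p =>
    isScaledList_scaledValues hq hlen.ge hgs
  rw [deltaPoly, Polynomial.eval_sub, Polynomial.eval_pow, Polynomial.eval_pow, sub_pos]
  induction k generalizing p with
  | zero => exact compareValues_powerValues_sound hg hq hp hx (hlist p) h n hn hn'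
  | succ k ih =>
    simp only [gridCheck, Bool.and_eq_true] at h
    rcases le_total (((p + p * p / (30 * p + 12000) : ℕ) : ℝ) / q) x with hle | hle
    · exact ih (Nat.add_pos_left hp _) h.2 hle
    · have hx0 : 0 ≤ x := le_trans (by positivity) hx
      have key := compareValues_sound hq (hlist p).tail (hlist _) h.1 n hn hn'
      calc (dArcaisPoly g (n + 1)).eval x ^ n
          ≤ (dArcaisPoly g (n + 1)).eval
              (((p + p * p / (30 * p + 12000) : ℕ) : ℝ) / q) ^ n :=
            pow_le_pow_left₀ (eval_dArcaisPoly_nonneg g hx0 _)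
              (eval_dArcaisPoly_mono g hx0 hle _) n
        _ < _ := key
        _ ≤ _ := pow_le_pow_left₀ (eval_dArcaisPoly_nonneg g (by positivity) _)
              (eval_dArcaisPoly_mono g (by positivity) hx _) _

end DArcais

/-! ### Subgroups of finite index in `ℤ × A` -/

/-- The index of a subgroup of `B × A` is the product of the indices of its image in `B` and its
intersection with `A`. -/
theorem index_eq_index_map_fst_mul_index_comap_inr {B A : Type*} [AddCommGroup B] [AddCommGroup A]
    (H : AddSubgroup (B × A)) :
    H.index = (H.map (AddMonoidHom.fst B A)).index * (H.comap (AddMonoidHom.inr B A)).index := by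
  have hker : (AddMonoidHom.fst B A).ker = (⊤ : AddSubgroup A).map (AddMonoidHom.inr B A) := by
    ext ⟨b, a⟩
    rw [AddMonoidHom.mem_ker, AddSubgroup.mem_map]
    constructor
    · rintro (rfl : b = 0)
      exact ⟨a, trivial, rfl⟩
    · rintro ⟨c, -, hc⟩
      exact (congrArg Prod.fst hc).symm
  -- In the tower `H ≤ H ⊔ ker fst ≤ B × A`, the upper index is that of the image; the lower one is
  -- found inside `A` by the second isomorphism theorem.
  have h1 : (H ⊔ (AddMonoidHom.fst B A).ker).index = (H.map (AddMonoidHom.fst B A)).index := by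
    rw [← AddSubgroup.comap_map_eq, AddSubgroup.index_comap_of_surjective _ Prod.fst_surjective]
  have h2 : H.relIndex (H ⊔ (AddMonoidHom.fst B A).ker) =
      (H.comap (AddMonoidHom.inr B A)).index := by
    rw [sup_comm, AddSubgroup.relIndex_sup_right, hker, ← AddSubgroup.relIndex_comap,
      AddSubgroup.relIndex_top_right]
  rw [← h1, ← h2, mul_comm, AddSubgroup.relIndex_mul_index le_sup_left]

section Extension

variable {A : Type*} [AddCommGroup A]

/-- The subgroup of `ℤ × A` generated by `0 × K` and a lift of `(d, q)`, where `q ∈ A ⧸ K`. -/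
def intProdSubgroup (d : ℤ) (K : AddSubgroup A) (q : A ⧸ K) : AddSubgroup (ℤ × A) where
  carrier := {p | ∃ k : ℤ, p.1 = k * d ∧ (p.2 : A ⧸ K) = k • q}
  zero_mem' := ⟨0, by simp⟩
  add_mem' := by
    rintro ⟨x, a⟩ ⟨y, b⟩ ⟨k, hk, hk'⟩ ⟨m, hm, hm'⟩
    refine ⟨k + m, ?_, ?_⟩
    · simp only [Prod.fst_add] at *
      rw [hk, hm, add_mul]
    · simp only [Prod.snd_add, QuotientAddGroup.mk_add] at *
      rw [hk', hm', add_smul]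
  neg_mem' := by
    rintro ⟨x, a⟩ ⟨k, hk, hk'⟩
    refine ⟨-k, ?_, ?_⟩
    · simp only [Prod.fst_neg] at *
      rw [hk, neg_mul]
    · simp only [Prod.snd_neg, QuotientAddGroup.mk_neg] at *
      rw [hk', neg_smul]

theorem mem_intProdSubgroup {d : ℤ} {K : AddSubgroup A} {q : A ⧸ K} {x : ℤ} {a : A} :
    (x, a) ∈ intProdSubgroup d K q ↔ ∃ k : ℤ, x = k * d ∧ (a : A ⧸ K) = k • q := Iff.rfl

theorem map_fst_intProdSubgroup (d : ℤ) (K : AddSubgroup A) (q : A ⧸ K) :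
    (intProdSubgroup d K q).map (AddMonoidHom.fst ℤ A) = AddSubgroup.zmultiples d := by
  ext x
  rw [AddSubgroup.mem_map, AddSubgroup.mem_zmultiples_iff]
  constructor
  · rintro ⟨⟨y, a⟩, ⟨k, hk, -⟩, rfl⟩
    exact ⟨k, by simpa using hk.symm⟩
  · rintro ⟨k, rfl⟩
    obtain ⟨a, ha⟩ := QuotientAddGroup.mk_surjective (k • q)
    exact ⟨(k * d, a), ⟨k, rfl, ha⟩, by simp⟩

theorem comap_inr_intProdSubgroup {d : ℤ} (hd : d ≠ 0) (K : AddSubgroup A) (q : A ⧸ K) :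
    (intProdSubgroup d K q).comap (AddMonoidHom.inr ℤ A) = K := by
  ext a
  rw [AddSubgroup.mem_comap, AddMonoidHom.inr_apply, mem_intProdSubgroup]
  constructor
  · rintro ⟨k, hk, hk'⟩
    have : k = 0 := by simpa [hd] using hk.symm
    simpa [this] using hk'
  · intro ha
    exact ⟨0, by simp, by simpa using ha⟩

theorem index_intProdSubgroup {d : ℕ} (hd : d ≠ 0) (K : AddSubgroup A) (q : A ⧸ K) :
    (intProdSubgroup (d : ℤ) K q).index = d * K.index := by
  rw [index_eq_index_map_fst_mul_index_comap_inr, map_fst_intProdSubgroup,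
    comap_inr_intProdSubgroup (by exact_mod_cast hd), Int.index_zmultiples, Int.natAbs_natCast]

theorem intProdSubgroup_injective {d : ℤ} (hd : d ≠ 0) (K : AddSubgroup A) :
    Function.Injective (intProdSubgroup d K) := by
  intro q r h
  obtain ⟨a, rfl⟩ := QuotientAddGroup.mk_surjective q
  have hmem : (d, a) ∈ intProdSubgroup d K r := h ▸ ⟨1, by simp, by simp⟩
  obtain ⟨k, hk, hk'⟩ := hmem
  have : k = 1 := by
    have : k * d = 1 * d := by rw [← hk, one_mul]
    exact mul_right_cancel₀ hd this
  simpa [this] using hk'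

/-- Nonzero index forces a nonzero projection `dℤ`; the fibre of `H` over `d` is then one coset of
`H ∩ A`, which is `q`. -/
theorem exists_eq_intProdSubgroup {H : AddSubgroup (ℤ × A)} (hH : H.index ≠ 0) :
    ∃ (d : ℕ) (q : A ⧸ H.comap (AddMonoidHom.inr ℤ A)), d ≠ 0 ∧
      H = intProdSubgroup (d : ℤ) _ q := by
  obtain ⟨z, hz⟩ := Int.subgroup_cyclic (H.map (AddMonoidHom.fst ℤ A))
  have hz' : H.map (AddMonoidHom.fst ℤ A) = AddSubgroup.zmultiples (z.natAbs : ℤ) := by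
    rw [hz, ← AddSubgroup.zmultiples_eq_closure, Int.zmultiples_natAbs]
  have hd : z.natAbs ≠ 0 := by
    have := index_eq_index_map_fst_mul_index_comap_inr H
    rw [hz', Int.index_zmultiples, Int.natAbs_natCast] at this
    intro h0
    rw [h0, zero_mul] at this
    exact hH this
  have hmem : (z.natAbs : ℤ) ∈ H.map (AddMonoidHom.fst ℤ A) :=
    hz' ▸ AddSubgroup.mem_zmultiples _
  obtain ⟨⟨y, a⟩, hya, hy⟩ := hmem
  obtain rfl : y = (z.natAbs : ℤ) := hy
  refine ⟨z.natAbs, (a : A ⧸ _), hd, ?_⟩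
  have hinr : ∀ (k : ℤ) (b : A), ((k * z.natAbs, b) ∈ H ↔
      (b : A ⧸ H.comap (AddMonoidHom.inr ℤ A)) = k • (a : A ⧸ _)) := by
    intro k b
    -- Subtracting `k` times the chosen lift `(d, a)` moves the question into `A`.
    have hsplit : (k * (z.natAbs : ℤ), b) = k • ((z.natAbs : ℤ), a) + (0, -(k • a) + b) :=
      Prod.ext (by simp) (by simp)
    rw [← QuotientAddGroup.mk_zsmul, eq_comm, QuotientAddGroup.eq, AddSubgroup.mem_comap,
      AddMonoidHom.inr_apply, hsplit,
      AddSubgroup.add_mem_cancel_left H (AddSubgroup.zsmul_mem H hya k)]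
  ext ⟨x, b⟩
  rw [mem_intProdSubgroup]
  constructor
  · intro hx
    have : x ∈ AddSubgroup.zmultiples (z.natAbs : ℤ) := hz' ▸ ⟨(x, b), hx, rfl⟩
    obtain ⟨k, hk⟩ := AddSubgroup.mem_zmultiples_iff.mp this
    obtain rfl : k * z.natAbs = x := by simpa using hk
    exact ⟨k, rfl, (hinr k b).mp hx⟩
  · rintro ⟨k, rfl, hk⟩
    exact (hinr k b).mpr hk

/-- Subgroups of `ℤ × A` of index `n` correspond to triples of a divisor `m` of `n`, a subgroup
of index `m` of `A` and an element of the quotient by it. -/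
theorem bijective_intProdSubgroup {n : ℕ} (hn : n ≠ 0) :
    Function.Bijective (fun t : Σ m : n.divisors, Σ K : {K : AddSubgroup A // K.index = m.1},
        A ⧸ K.1 =>
      (⟨intProdSubgroup ((n / t.1.1 : ℕ) : ℤ) t.2.1.1 t.2.2, by
        rw [index_intProdSubgroup (Nat.div_ne_zero_iff_of_dvd (Nat.dvd_of_mem_divisors t.1.2) |>.mpr
          ⟨hn, (Nat.pos_of_mem_divisors t.1.2).ne'⟩), t.2.1.2,
          Nat.div_mul_cancel (Nat.dvd_of_mem_divisors t.1.2)]⟩ :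
        {H : AddSubgroup (ℤ × A) // H.index = n})) := by
  have hdiv : ∀ m : n.divisors, ((n / m.1 : ℕ) : ℤ) ≠ 0 := fun m => by
    exact_mod_cast (Nat.div_ne_zero_iff_of_dvd (Nat.dvd_of_mem_divisors m.2)).mpr
      ⟨hn, (Nat.pos_of_mem_divisors m.2).ne'⟩
  constructor
  · rintro ⟨⟨m, hm⟩, ⟨K, hK⟩, q⟩ ⟨⟨m', hm'⟩, ⟨K', hK'⟩, q'⟩ h
    have h := congrArg Subtype.val h
    dsimp only at h hK hK'
    have hKK : K = K' := by
      rw [← comap_inr_intProdSubgroup (hdiv ⟨m, hm⟩) K q, h, comap_inr_intProdSubgroup]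
      exact hdiv ⟨m', hm'⟩
    subst hKK
    obtain rfl : m = m' := hK.symm.trans hK'
    obtain rfl := intProdSubgroup_injective (hdiv ⟨m, hm⟩) K h
    rfl
  · rintro ⟨H, hH⟩
    obtain ⟨d, q, hd, hHq⟩ := exists_eq_intProdSubgroup (hH.trans_ne hn)
    generalize H.comap (AddMonoidHom.inr ℤ A) = K at q hHq
    have hidx : d * K.index = n := by
      rw [← index_intProdSubgroup hd _ q, ← hHq, hH]
    have hpos : 0 < K.index :=
      Nat.pos_of_ne_zero fun h0 => hn (by rw [← hidx, h0, mul_zero])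
    have hd' : n / K.index = d := by
      rw [← hidx, Nat.mul_div_cancel _ hpos]
    refine ⟨⟨⟨K.index, Nat.mem_divisors.mpr ⟨Dvd.intro_left d hidx, hn⟩⟩, ⟨K, rfl⟩, q⟩, ?_⟩
    refine Subtype.ext ?_
    dsimp only
    rw [hd', ← hHq]

/-- The quotient by `K` contributes the factor `m`. Finiteness is carried along because `Nat.card`
is `0` on infinite types. -/
theorem finite_and_card_index_eq (hA : ∀ m ≠ 0, Finite {K : AddSubgroup A // K.index = m})
    {n : ℕ} (hn : n ≠ 0) : Finite {H : AddSubgroup (ℤ × A) // H.index = n} ∧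
      Nat.card {H : AddSubgroup (ℤ × A) // H.index = n} =
        ∑ m ∈ n.divisors, m * Nat.card {K : AddSubgroup A // K.index = m} := by
  have e := Equiv.ofBijective _ (bijective_intProdSubgroup (A := A) hn)
  have hne : ∀ m : n.divisors, m.1 ≠ 0 := fun m => (Nat.pos_of_mem_divisors m.2).ne'
  have hfin : ∀ m : n.divisors, Finite {K : AddSubgroup A // K.index = m.1} := fun m =>
    hA _ (hne m)
  have hquot : ∀ (m : n.divisors) (K : {K : AddSubgroup A // K.index = m.1}),
      Finite (A ⧸ K.1) := fun m K =>
    Nat.finite_of_card_ne_zero (K.2.trans_ne (hne m))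
  refine ⟨Finite.of_equiv _ e, ?_⟩
  rw [← Nat.card_congr e, Nat.card_sigma, ← Finset.sum_coe_sort n.divisors]
  refine Finset.sum_congr rfl fun m _ => ?_
  have := Fintype.ofFinite {K : AddSubgroup A // K.index = m.1}
  rw [Nat.card_sigma, Finset.sum_congr rfl fun K _ => (K.2 : Nat.card (A ⧸ K.1) = m.1),
    Finset.sum_const, Finset.card_univ, Nat.card_eq_fintype_card, smul_eq_mul, mul_comm]

end Extension

/-! ### Recursion for the subgroup counts of `ℤ^l` -/

/-- Transport of the subgroups of given index along an isomorphism. -/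
def indexSubtypeEquiv {A B : Type*} [AddCommGroup A] [AddCommGroup B] (e : A ≃+ B) (n : ℕ) :
    {H : AddSubgroup A // H.index = n} ≃ {H : AddSubgroup B // H.index = n} :=
  e.mapAddSubgroup.toEquiv.subtypeEquiv fun H => by
    change H.index = n ↔ (H.map (e : A →+ B)).index = n
    rw [AddSubgroup.index_map_equiv]

/-- The recursive value of `subgroupCount`. -/
def latticeCount : ℕ → ℕ → ℕ
  | 0, n => if n = 1 then 1 else 0
  | l + 1, n => ∑ m ∈ n.divisors, m * latticeCount l m

theorem finite_and_subgroupCount_eq (l : ℕ) {n : ℕ} (hn : n ≠ 0) :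
    Finite {H : AddSubgroup (Fin l → ℤ) // H.index = n} ∧
      subgroupCount l n = latticeCount l n := by
  induction l generalizing n with
  | zero =>
    have : Finite (AddSubgroup (Fin 0 → ℤ)) := inferInstance
    refine ⟨inferInstance, ?_⟩
    have hidx : ∀ H : AddSubgroup (Fin 0 → ℤ), H.index = 1 := fun H => by
      rw [Subsingleton.elim H ⊤, AddSubgroup.index_top]
    rw [subgroupCount, latticeCount]
    split_ifs with h
    · subst h
      have : Unique {H : AddSubgroup (Fin 0 → ℤ) // H.index = 1} :=
        { default := ⟨⊤, hidx _⟩, uniq := fun H => Subtype.ext (Subsingleton.elim _ _) }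
      exact Nat.card_unique
    · have : IsEmpty {H : AddSubgroup (Fin 0 → ℤ) // H.index = n} :=
        ⟨fun H => h ((hidx H.1).symm.trans H.2).symm⟩
      exact Nat.card_of_isEmpty
  | succ l ih =>
    let e := indexSubtypeEquiv (Fin.consLinearEquiv ℤ (fun _ : Fin (l + 1) => ℤ)).toAddEquiv n
    obtain ⟨h1, h2⟩ := finite_and_card_index_eq (A := Fin l → ℤ) (fun m hm => (ih hm).1) hn
    refine ⟨Finite.of_equiv _ e, ?_⟩
    rw [subgroupCount, ← Nat.card_congr e, h2, latticeCount]
    refine Finset.sum_congr rfl fun m hm => ?_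
    rw [← (ih (Nat.pos_of_mem_divisors hm).ne').2, subgroupCount]

/-! ### Numerical certificates -/

/-- The numbers of subgroups of `ℤ³` of index `1, …, 26`. -/
def latticeCountsThree : List ℕ :=
  [1, 7, 13, 35, 31, 91, 57, 155, 130, 217, 133, 455, 183, 399, 403, 651, 307, 910, 381, 1085,
    741, 931, 553, 2015, 806, 1281]

/-- The numbers of subgroups of `ℤ⁴` of index `1, …, 26`. -/
def latticeCountsFour : List ℕ :=
  [1, 15, 40, 155, 156, 600, 400, 1395, 1210, 2340, 1464, 6200, 2380, 6000, 6240, 11811, 5220,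
    18150, 7240, 24180, 16000, 21960, 12720, 55800, 20306, 35700]

theorem getD_latticeCountsThree :
    ∀ i < 26, latticeCountsThree.getD i 0 = latticeCount 3 (i + 1) := by
  decide +kernel

theorem getD_latticeCountsFour :
    ∀ i < 26, latticeCountsFour.getD i 0 = latticeCount 4 (i + 1) := by
  decide +kernel

/-- Denominator and first numerator are both `256`, so the grid starts at `x = 1`; the tail test is
applied after `291` steps. Up to rounding, the relative step `p / (30 p + 12000)` grows towards
`1/30`. -/
theorem gridCheck_latticeCountsThree :
    gridCheck latticeCountsThree 256 291 256 (scaledValues latticeCountsThree 256 256 26) =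
      true := by
  decide +kernel

theorem gridCheck_latticeCountsFour :
    gridCheck latticeCountsFour 256 314 256 (scaledValues latticeCountsFour 256 256 26) =
      true := by
  decide +kernel

theorem eval_deltaPoly_subgroupCount_pos {l k : ℕ} {gs : List ℕ} (hlen : gs.length = 26)
    (hgs : ∀ i < 26, gs.getD i 0 = latticeCount l (i + 1)) (h0 : gs.getD 0 0 = 1)
    (h : gridCheck gs 256 k 256 (scaledValues gs 256 256 26) = true) {n : ℕ} (hn : 8 ≤ n)
    (hn' : n ≤ 25) {x : ℝ} (hx : 1 ≤ x) : 0 < (deltaPoly (subgroupCount l) n).eval x := by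
  have hval : ∀ i < gs.length, gs.getD i 0 = subgroupCount l (i + 1) := fun i hi => by
    rw [hgs i (hlen ▸ hi), (finite_and_subgroupCount_eq l i.succ_ne_zero).2]
  have h1 : 1 ≤ subgroupCount l 1 := by
    rw [← hval 0 (by omega), h0]
  exact gridCheck_sound (by norm_num) hlen hval h1 (by norm_num) h (by norm_num; exact hx) hn hn'

theorem mainTheorem8 (l n : ℕ) (hl : l = 3 ∨ l = 4) (hn : 8 ≤ n) (hn' : n ≤ 25)
    (x : ℝ) (hx : 1 ≤ x) : 0 < (deltaPoly (subgroupCount l) n).eval x := by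
  rcases hl with rfl | rfl
  · exact eval_deltaPoly_subgroupCount_pos rfl getD_latticeCountsThree rfl
      gridCheck_latticeCountsThree hn hn' hx
  · exact eval_deltaPoly_subgroupCount_pos rfl getD_latticeCountsFour rfl
      gridCheck_latticeCountsFour hn hn' hx
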